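/- Let $F(z)=B_1+z^{-1}B_2+\cdots+z^{1-n}B_n$ be a causal $p\times m$-valued finite impulse response function ($B_k\in\mathbb C^{p\times m}$; $B_n=0$ is allowed) in the class $\mathcal U$, that is, for all $|z|=1$, $F(z)^*F(z)=I_m$ if $p\ge m$ and $F(z)F(z)^*=I_p$ if $m\ge p$. Let $d$ be the McMillan degree of $F$, i.e. the smallest $\nu$ such that $F(z)=C(zI_\nu-A)^{-1}B+D$ for some complex matrices $A,B,C,D$ with $A$ of size $\nu\times\nu$. Put $B_k:=0$ for $k>n$. For unit vectors $v_1,\dots,v_d$ in $\mathbb C^r$, with $Q_j:=I_r-v_jv_j^*$, define for $k\ge 0$ $$E_k(v_1,\dots,v_d):=\sum_{1\le j_1<\cdots<j_k\le d}X_1X_2\cdots X_d,\qquad X_j=\begin{cases}v_jv_j^*&\text{if } j\in\{j_1,\dots,j_k\},\\ Q_j&\text{otherwise,}\end{cases}$$ so that $E_0=Q_1\cdots Q_d$, $E_1=\sum_{j=1}^dQ_1\cdots Q_{j-1}v_jv_j^*Q_{j+1}\cdots Q_d$, $\dots$, $E_d=v_1v_1^*\cdots v_dv_d^*$, and $E_k=0$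 for $k>d$ (for $d=0$, $E_0=I_r$). 1. If $p=m$, there are unit vectors $v_1,\dots,v_d\in\mathbb C^p$ and a unitary matrix $U\in\mathbb C^{p\times p}$ with $B_{k+1}=E_k(v_1,\dots,v_d)\,U$ for all $k\ge0$; and there are unit vectors $v_1,\dots,v_d\in\mathbb C^p$ and a unitary matrix $U\in\mathbb C^{p\times p}$ with $B_{k+1}=U\,E_k(v_1,\dots,v_d)$ for all $k\ge0$. 2. If $p\ge m$, there are unit vectors $v_1,\dots,v_d\in\mathbb C^p$ and $U_{\rm iso}\in\mathbb C^{p\times m}$ with $U_{\rm iso}^*U_{\rm iso}=I_m$ and $B_{k+1}=E_k(v_1,\dots,v_d)\,U_{\rm iso}$ for all $k\ge0$. 3. If $m\ge p$, there are unit vectors $v_1,\dots,v_d\in\mathbb C^m$ and $U_{\rm coiso}\in\mathbb C^{p\times m}$ with $U_{\rm coiso}U_{\rm coiso}^*=I_p$ and $B_{k+1}=U_{\rm coiso}\,E_k(v_1,\dots,v_d)$ for all $k\ge0$. In particular, when $n=d+1$, the last coefficient $B_n$ is $v_1v_1^*\cdots v_dv_d^*$ up to the same factor. -/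

import Mathlib

open Matrix

/-- The causal finite impulse response function
`F(z) = B₁ + z⁻¹ B₂ + ⋯ + z^(1-n) B_n`; only `B 1, …, B n` are used. -/
noncomputable def causalFIR {p m : ℕ} (n : ℕ) (B : ℕ → Matrix (Fin p) (Fin m) ℂ) (z : ℂ) :
    Matrix (Fin p) (Fin m) ℂ :=
  ∑ k ∈ Finset.Icc 1 n, z ^ (1 - (k : ℤ)) • B k

/-- The class `𝒰` of matrix functions with unitary symmetry on the unit circle: isometric there
when `p ≥ m`, co-isometric there when `m ≥ p` (so unitary when `p = m`). -/
def InClassU {p m : ℕ} (F : ℂ → Matrix (Fin p) (Fin m) ℂ) : Prop :=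
  (m ≤ p → ∀ z : ℂ, ‖z‖ = 1 → (F z)ᴴ * F z = 1) ∧
  (p ≤ m → ∀ z : ℂ, ‖z‖ = 1 → F z * (F z)ᴴ = 1)

/-- `F(z) = C (z I - A)⁻¹ B + D` as rational functions of `z`, that is, for all but finitely
many complex numbers `z`. -/
def IsRealization {p m ν : ℕ} (F : ℂ → Matrix (Fin p) (Fin m) ℂ)
    (A : Matrix (Fin ν) (Fin ν) ℂ) (B : Matrix (Fin ν) (Fin m) ℂ)
    (C : Matrix (Fin p) (Fin ν) ℂ) (D : Matrix (Fin p) (Fin m) ℂ) : Prop :=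
  ∀ᶠ z : ℂ in Filter.cofinite,
    F z = C * (z • (1 : Matrix (Fin ν) (Fin ν) ℂ) - A)⁻¹ * B + D

/-- The McMillan degree of a causal (proper) rational function `F` is `d`: the number `d` is the
smallest state space dimension of a realization of `F`. -/
def HasMcMillanDegree {p m : ℕ} (F : ℂ → Matrix (Fin p) (Fin m) ℂ) (d : ℕ) : Prop :=
  IsLeast {ν : ℕ | ∃ (A : Matrix (Fin ν) (Fin ν) ℂ) (B : Matrix (Fin ν) (Fin m) ℂ)
    (C : Matrix (Fin p) (Fin ν) ℂ) (D : Matrix (Fin p) (Fin m) ℂ), IsRealization F A B C D} d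

/-- The matrix `v v*`, the rank one orthogonal projection onto the line of `v` if `v* v = 1`. -/
def lineProj {r : ℕ} (v : Fin r → ℂ) : Matrix (Fin r) (Fin r) ℂ :=
  vecMulVec v (star v)

/-- `∑ over j₁ < ⋯ < j_k` of the product `X₁ X₂ ⋯ X_d`, in this order, where `X_j = v_j v_j*` for
`j ∈ {j₁, …, j_k}` and `X_j = Q_j = I - v_j v_j*` for the other `j`.  For `k = 0` this is
`Q₁ ⋯ Q_d`, for `k = d` it is `v₁ v₁* ⋯ v_d v_d*`, and for `k > d` it is `0`. -/
noncomputable def projCoeff {r d : ℕ} (v : Fin d → Fin r → ℂ) (k : ℕ) :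
    Matrix (Fin r) (Fin r) ℂ :=
  ∑ S ∈ Finset.powersetCard k (Finset.univ : Finset (Fin d)),
    (List.ofFn fun j : Fin d => if j ∈ S then lineProj (v j) else 1 - lineProj (v j)).prod

/-!
With `w = z⁻¹` the function becomes the matrix polynomial `P(w) = ∑ b k w ^ k`, `b k = B (k + 1)`
for `k < n`, and `∑ w ^ k E_k` is the product of the elementary factors `1 - L_j + w L_j`,
`L_j = v_j v_j*`. The isometric case is the factorization `P(w) = ∏ (1 - L_j + w L_j) U`.

The McMillan degree is the dimension of the range `X` of the block Hankel operator of `P`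
(`HasMcMillanDegree.finrank_hankelSpace`): a realization of size `ν` has Markov parameters
`b (k + 1) = C A ^ k G`, which bounds `dim X` by `ν`, and the shift realization has size `dim X`.

The factorization (`exists_projCoeff_of_isOrthonormalSeq`) is by induction on `dim X`. The backward
shift `S` is nilpotent on `X`, so if `X ≠ 0` it contains a sequence `(v, 0, 0, …)` with `v`
a unit vector. Isometry of `P` on the circle makes `X` orthogonal to the coefficient sequences of
`P(w) u`, whence `v* b 0 = 0`. Put `L = v v*`. Then `(1 - L + w⁻¹ L) P(w)` is again a polynomial,
isometric on the circle, and its Hankel space is the image of `X` under `1 - L + L S`. The kernel of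
this map on `X` is the line of `(v, 0, 0, …)`, so the dimension drops by exactly one
(`finrank_hankelSpace_peel`). If `X = 0`, then `P` is a constant isometry.

The co-isometric case follows by passing to the adjoint coefficients, which have the same Hankel
rank, because taking adjoints of the `E_k` reverses the order of the `v_j`. The square case is
contained in both.
-/

/-! ### Hankel space of a matrix sequence -/

section Hankel

/-- The matrix polynomial `P(w) = ∑ b k w ^ k` (`k < n`) is isometric on the unit circle, expressed
through the Fourier coefficients of `P* P`: `∑ (b k)* b (k + j)` is `1` for `j = 0` and `0` for
`j > 0`. The negative coefficients are the adjoints of these and need not be listed. -/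
def IsOrthonormalSeq {p m : ℕ} (n : ℕ) (b : ℕ → Matrix (Fin p) (Fin m) ℂ) : Prop :=
  ∀ j, ∑ k ∈ Finset.range n, (b k)ᴴ * b (k + j) = if j = 0 then 1 else 0

/-- The range of the block Hankel matrix `(b (i + j + 1))`: the span of the sequences
`i ↦ b (i + j + 1) u`. It is the state space of the shift realization of `∑ b k z ^ (-k)`. -/
def hankelSpace {p m : ℕ} (b : ℕ → Matrix (Fin p) (Fin m) ℂ) : Submodule ℂ (ℕ → Fin p → ℂ) :=
  Submodule.span ℂ {x | ∃ (j : ℕ) (u : Fin m → ℂ), x = fun i => b (i + j + 1) *ᵥ u}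

/-- The backward shift `(x₀, x₁, …) ↦ (x₁, x₂, …)`. -/
def backwardShift (p : ℕ) : (ℕ → Fin p → ℂ) →ₗ[ℂ] (ℕ → Fin p → ℂ) :=
  LinearMap.funLeft ℂ (Fin p → ℂ) Nat.succ

theorem backwardShift_apply {p : ℕ} (x : ℕ → Fin p → ℂ) (i : ℕ) :
    backwardShift p x i = x (i + 1) := rfl

theorem backwardShift_pow_apply {p : ℕ} (k : ℕ) (x : ℕ → Fin p → ℂ) (i : ℕ) :
    (backwardShift p ^ k) x i = x (i + k) := by
  induction k generalizing x with
  | zero => simp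
  | succ k ih => rw [pow_succ, Module.End.mul_apply, ih, backwardShift_apply]; rfl

variable {p m n : ℕ} {b : ℕ → Matrix (Fin p) (Fin m) ℂ}

theorem mem_hankelSpace (j : ℕ) (u : Fin m → ℂ) :
    (fun i => b (i + j + 1) *ᵥ u) ∈ hankelSpace b :=
  Submodule.subset_span ⟨j, u, rfl⟩

theorem backwardShift_mem_hankelSpace {x : ℕ → Fin p → ℂ} (hx : x ∈ hankelSpace b) :
    backwardShift p x ∈ hankelSpace b := by
  have h : hankelSpace b ≤ (hankelSpace b).comap (backwardShift p) := by
    refine Submodule.span_le.2 ?_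
    rintro _ ⟨j, u, rfl⟩
    have : backwardShift p (fun i => b (i + j + 1) *ᵥ u)
        = fun i => b (i + (j + 1) + 1) *ᵥ u := by
      funext i
      rw [backwardShift_apply, show i + 1 + j + 1 = i + (j + 1) + 1 by omega]
    simpa only [SetLike.mem_coe, Submodule.mem_comap, this] using mem_hankelSpace (j + 1) u
  exact h hx

theorem backwardShift_pow_mem_hankelSpace (k : ℕ) {x : ℕ → Fin p → ℂ}
    (hx : x ∈ hankelSpace b) : (backwardShift p ^ k) x ∈ hankelSpace b := by
  induction k with
  | zero => simpa
  | succ k ih =>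
    rw [pow_succ', Module.End.mul_apply]
    exact backwardShift_mem_hankelSpace ih

theorem eq_zero_of_mem_hankelSpace (hb : ∀ k, n ≤ k → b k = 0) {x : ℕ → Fin p → ℂ}
    (hx : x ∈ hankelSpace b) {i : ℕ} (hi : n ≤ i) : x i = 0 := by
  have h : hankelSpace b ≤ LinearMap.ker (LinearMap.proj (R := ℂ) (φ := fun _ => Fin p → ℂ) i) := by
    refine Submodule.span_le.2 ?_
    rintro _ ⟨j, u, rfl⟩
    simp [hb (i + j + 1) (by omega)]
  exact h hx

theorem finiteDimensional_hankelSpace (hb : ∀ k, n ≤ k → b k = 0) :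
    FiniteDimensional ℂ (hankelSpace b) := by
  let f : hankelSpace b →ₗ[ℂ] (Fin n → Fin p → ℂ) :=
    (LinearMap.funLeft ℂ (Fin p → ℂ) Fin.val).comp (hankelSpace b).subtype
  refine Module.Finite.of_injective f ((injective_iff_map_eq_zero f).2 fun x hx => ?_)
  ext1
  funext i
  by_cases hi : i < n
  · exact congrFun hx ⟨i, hi⟩
  · exact eq_zero_of_mem_hankelSpace hb x.2 (not_lt.1 hi)

/-- The Hankel space is orthogonal to the sequences `i ↦ b i u`: a generator is a positive
backward shift of such a sequence, and the correlations at positive lags vanish. -/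
theorem sum_conjTranspose_mulVec_eq_zero (ho : IsOrthonormalSeq n b) {x : ℕ → Fin p → ℂ}
    (hx : x ∈ hankelSpace b) : ∑ k ∈ Finset.range n, (b k)ᴴ *ᵥ x k = 0 := by
  let f : (ℕ → Fin p → ℂ) →ₗ[ℂ] (Fin m → ℂ) :=
    ∑ k ∈ Finset.range n, (b k)ᴴ.mulVecLin.comp (LinearMap.proj k)
  have h : hankelSpace b ≤ LinearMap.ker f := by
    refine Submodule.span_le.2 ?_
    rintro _ ⟨j, u, rfl⟩
    have := congrArg (· *ᵥ u) (ho (j + 1))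
    simpa [f, Matrix.sum_mulVec, ← add_assoc] using this
  simpa [f] using h hx

open scoped ComplexOrder in
/-- The backward shift is nilpotent on the Hankel space of a finite sequence; if that
space is nonzero, the kernel there contains a sequence `(v, 0, 0, …)` with `v` a unit vector. -/
theorem exists_unit_single_mem_hankelSpace (hb : ∀ k, n ≤ k → b k = 0)
    (hne : hankelSpace b ≠ ⊥) :
    ∃ v : Fin p → ℂ, star v ⬝ᵥ v = 1 ∧ Pi.single 0 v ∈ hankelSpace b := by
  obtain ⟨x, hx, hx0⟩ := Submodule.exists_mem_ne_zero_of_ne_bot hne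
  obtain ⟨i₀, hi₀⟩ := Function.ne_iff.1 hx0
  have hfin : ∃ i, x i ≠ 0 ∧ ∀ j, i < j → x j = 0 := by
    -- the last index at which `x` does not vanish
    classical
    have hlt : i₀ ≤ n := by
      by_contra h
      exact hi₀ (eq_zero_of_mem_hankelSpace hb hx (by omega))
    refine ⟨Nat.findGreatest (fun i => x i ≠ 0) n,
      Nat.findGreatest_spec (P := fun i => x i ≠ 0) hlt hi₀, fun j hj => ?_⟩
    by_cases hjn : j ≤ n
    · simpa using Nat.findGreatest_is_greatest hj hjn
    · exact eq_zero_of_mem_hankelSpace hb hx (by omega)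
  obtain ⟨i, hi, hlast⟩ := hfin
  have hy : Pi.single 0 (x i) ∈ hankelSpace b := by
    have h : (backwardShift p ^ i) x = Pi.single 0 (x i) := by
      funext k
      rw [backwardShift_pow_apply]
      rcases Nat.eq_zero_or_pos k with rfl | hk
      · simp
      · rw [Pi.single_eq_of_ne hk.ne', hlast _ (by omega)]
    exact h ▸ backwardShift_pow_mem_hankelSpace i hx
  have hpos : 0 < star (x i) ⬝ᵥ x i := Matrix.dotProduct_star_self_pos_iff.2 hi
  obtain ⟨r, hr, hrx⟩ : ∃ r : ℝ, 0 < r ∧ star (x i) ⬝ᵥ x i = (r : ℂ) := by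
    rw [Complex.lt_def] at hpos
    exact ⟨_, hpos.1, Complex.ext rfl hpos.2.symm⟩
  let s : ℂ := ((Real.sqrt r)⁻¹ : ℝ)
  refine ⟨s • x i, ?_, ?_⟩
  · have hs : star s = s := Complex.conj_ofReal _
    rw [star_smul, smul_dotProduct, dotProduct_smul, hrx, hs, smul_smul, smul_eq_mul]
    have h : (Real.sqrt r)⁻¹ * (Real.sqrt r)⁻¹ * r = 1 := by
      rw [← mul_inv, Real.mul_self_sqrt hr.le, inv_mul_cancel₀ hr.ne']
    calc s * s * (r : ℂ) = (((Real.sqrt r)⁻¹ * (Real.sqrt r)⁻¹ * r : ℝ) : ℂ) := by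
          push_cast [s]; rfl
      _ = 1 := by rw [h, Complex.ofReal_one]
  · rw [Pi.single_smul]
    exact Submodule.smul_mem _ _ hy

end Hankel

/-! ### Splitting off an elementary factor -/

theorem lineProj_mulVec {r : ℕ} (v x : Fin r → ℂ) :
    lineProj v *ᵥ x = (star v ⬝ᵥ x) • v := by
  rw [lineProj, vecMulVec_mulVec, op_smul_eq_smul]

theorem lineProj_conjTranspose {r : ℕ} (v : Fin r → ℂ) : (lineProj v)ᴴ = lineProj v := by
  rw [lineProj, conjTranspose_vecMulVec, star_star]

theorem lineProj_mul_self {r : ℕ} {v : Fin r → ℂ} (hv : star v ⬝ᵥ v = 1) :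
    lineProj v * lineProj v = lineProj v := by
  simp [lineProj, vecMulVec_mul_vecMulVec, hv]

/-- The coefficients of `(1 - L + w⁻¹ L) P(w)`, where `P(w) = ∑ b k w ^ k` and `L = v v*`. The
term in `w⁻¹` is left out; it vanishes when `L b 0 = 0`. -/
def peel {p m : ℕ} (v : Fin p → ℂ) (b : ℕ → Matrix (Fin p) (Fin m) ℂ) (k : ℕ) :
    Matrix (Fin p) (Fin m) ℂ :=
  (1 - lineProj v) * b k + lineProj v * b (k + 1)

section Peel
variable {p m n : ℕ} {b : ℕ → Matrix (Fin p) (Fin m) ℂ} {v : Fin p → ℂ}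

theorem peel_isOrthonormalSeq (hb : ∀ k, n ≤ k → b k = 0) (ho : IsOrthonormalSeq n b)
    (hv : star v ⬝ᵥ v = 1) (hv0 : lineProj v * b 0 = 0) : IsOrthonormalSeq n (peel v b) := by
  intro j
  rw [← ho j]
  set L := lineProj v with hL
  have hLL : L * L = L := lineProj_mul_self hv
  have hLH : Lᴴ = L := lineProj_conjTranspose v
  have hv0' : (b 0)ᴴ * L = 0 := by rw [← hLH, ← conjTranspose_mul, hv0, conjTranspose_zero]
  -- the difference of the correlations telescopes, with boundary terms containing `L b 0` or `b n`
  have hterm : ∀ k, (peel v b k)ᴴ * peel v b (k + j) =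
      (b k)ᴴ * b (k + j)
        + ((b (k + 1))ᴴ * L * b (k + 1 + j) - (b k)ᴴ * L * b (k + j)) := by
    intro k
    have h1 : (1 - L) * (1 - L) = 1 - L := by
      simp only [Matrix.sub_mul, Matrix.mul_sub, hLL, Matrix.one_mul, Matrix.mul_one]; abel
    have h2 : (1 - L) * L = 0 := by rw [Matrix.sub_mul, hLL, Matrix.one_mul, sub_self]
    have h3 : L * (1 - L) = 0 := by rw [Matrix.mul_sub, hLL, Matrix.mul_one, sub_self]
    have e1 : ∀ (x y : Matrix (Fin p) (Fin p) ℂ) (s t : Matrix (Fin p) (Fin m) ℂ),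
        (sᴴ * x) * (y * t) = sᴴ * (x * y) * t := fun x y s t => by
      simp only [Matrix.mul_assoc]
    rw [peel, peel, ← hL, conjTranspose_add, conjTranspose_mul, conjTranspose_mul,
      conjTranspose_sub, conjTranspose_one, hLH, Matrix.add_mul, Matrix.mul_add, Matrix.mul_add,
      e1, e1, e1, e1, h1, h2, h3, hLL, show k + j + 1 = k + 1 + j by omega]
    simp only [Matrix.mul_sub, Matrix.sub_mul, Matrix.mul_zero, Matrix.zero_mul, Matrix.mul_one]
    abel
  rw [Finset.sum_congr rfl fun k _ => hterm k, Finset.sum_add_distrib,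
    Finset.sum_range_sub (fun k => (b k)ᴴ * L * b (k + j)), hb n le_rfl, hv0']
  simp

/-- The map `x ↦ (1 - L) x + L S x` on sequences, `S` being the backward shift. -/
def peelSeq (v : Fin p → ℂ) : (ℕ → Fin p → ℂ) →ₗ[ℂ] (ℕ → Fin p → ℂ) :=
  LinearMap.pi fun i => (1 - lineProj v).mulVecLin.comp (LinearMap.proj i)
    + (lineProj v).mulVecLin.comp (LinearMap.proj (i + 1))

theorem peelSeq_apply (v : Fin p → ℂ) (x : ℕ → Fin p → ℂ) (i : ℕ) :
    peelSeq v x i = (1 - lineProj v) *ᵥ x i + lineProj v *ᵥ x (i + 1) := rfl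

theorem hankelSpace_peel (v : Fin p → ℂ) (b : ℕ → Matrix (Fin p) (Fin m) ℂ) :
    hankelSpace (peel v b) = (hankelSpace b).map (peelSeq v) := by
  have hgen : ∀ (j : ℕ) (u : Fin m → ℂ), (fun i => peel v b (i + j + 1) *ᵥ u)
      = peelSeq v fun i => b (i + j + 1) *ᵥ u := by
    intro j u
    funext i
    rw [peelSeq_apply, peel, Matrix.add_mulVec, ← mulVec_mulVec, ← mulVec_mulVec,
      show i + j + 1 + 1 = i + 1 + j + 1 by omega]
  rw [hankelSpace, hankelSpace, Submodule.map_span]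
  congr 1
  ext x
  constructor
  · rintro ⟨j, u, rfl⟩
    exact ⟨_, ⟨j, u, rfl⟩, (hgen j u).symm⟩
  · rintro ⟨_, ⟨j, u, rfl⟩, rfl⟩
    exact ⟨j, u, (hgen j u).symm⟩

theorem peelSeq_single (hv : star v ⬝ᵥ v = 1) : peelSeq v (Pi.single 0 v) = 0 := by
  funext i
  rw [peelSeq_apply]
  rcases Nat.eq_zero_or_pos i with rfl | hi
  · simp [sub_mulVec, lineProj_mulVec, hv]
  · simp [Pi.single_eq_of_ne hi.ne']

theorem eq_smul_single_of_peelSeq_eq_zero (hv : star v ⬝ᵥ v = 1) {x : ℕ → Fin p → ℂ}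
    (hx : peelSeq v x = 0) : x = (star v ⬝ᵥ x 0) • Pi.single 0 v := by
  have hi : ∀ i, x i - (star v ⬝ᵥ x i) • v + (star v ⬝ᵥ x (i + 1)) • v = 0 := fun i => by
    have := congrFun hx i
    rwa [peelSeq_apply, sub_mulVec, one_mulVec, lineProj_mulVec, lineProj_mulVec] at this
  have hs : ∀ i, star v ⬝ᵥ x (i + 1) = 0 := fun i => by
    have := congrArg (star v ⬝ᵥ ·) (hi i)
    simpa [dotProduct_add, dotProduct_sub, dotProduct_smul, hv] using this
  funext i
  have h := hi i
  rw [hs i, zero_smul, add_zero, sub_eq_zero] at h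
  rcases i with _ | i
  · simpa using h
  · rw [hs i, zero_smul] at h
    simp [h]

/-- The map `peelSeq v` sends the Hankel space of `b` onto that of `peel v b`, and its kernel there
is the line of `(v, 0, 0, …)`. -/
theorem finrank_hankelSpace_peel [FiniteDimensional ℂ (hankelSpace b)]
    (hv : star v ⬝ᵥ v = 1) (hmem : Pi.single 0 v ∈ hankelSpace b) :
    Module.finrank ℂ (hankelSpace (peel v b)) + 1 = Module.finrank ℂ (hankelSpace b) := by
  let f := (peelSeq v).domRestrict (hankelSpace b)
  have hker : Module.finrank ℂ (LinearMap.ker f) = 1 := by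
    refine finrank_eq_one (⟨⟨Pi.single 0 v, hmem⟩, peelSeq_single hv⟩ : LinearMap.ker f) ?_ ?_
    · intro h
      have h' : (Pi.single 0 v : ℕ → Fin p → ℂ) = 0 :=
        congrArg (fun y : LinearMap.ker f => (y.1.1 : ℕ → Fin p → ℂ)) h
      have hv0 : v = 0 := by simpa using h'
      simp [hv0] at hv
    · rintro ⟨⟨x, hx⟩, hx'⟩
      refine ⟨star v ⬝ᵥ x 0, ?_⟩
      ext1; ext1
      exact (eq_smul_single_of_peelSeq_eq_zero hv hx').symm
  have hrange : LinearMap.range f = hankelSpace (peel v b) := by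
    rw [hankelSpace_peel, LinearMap.range_domRestrict]
  rw [← LinearMap.finrank_range_add_finrank_ker f, hker, hrange]

end Peel

/-! ### Products of elementary factors -/

theorem projCoeff_cons_zero {r d : ℕ} (v₀ : Fin r → ℂ) (v : Fin d → Fin r → ℂ) :
    projCoeff (Fin.cons v₀ v : Fin (d + 1) → Fin r → ℂ) 0
      = (1 - lineProj v₀) * projCoeff v 0 := by
  simp [projCoeff, List.ofFn_succ]

/-- With `L = v₀ v₀*`, this compares the coefficients of `w ^ (k + 1)` in
`(1 - L + w L) ∏ (1 - v_j v_j* + w v_j v_j*)`. -/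
theorem projCoeff_cons_succ {r d : ℕ} (v₀ : Fin r → ℂ) (v : Fin d → Fin r → ℂ) (k : ℕ) :
    projCoeff (Fin.cons v₀ v : Fin (d + 1) → Fin r → ℂ) (k + 1)
      = (1 - lineProj v₀) * projCoeff v (k + 1) + lineProj v₀ * projCoeff v k := by
  classical
  have h0 : (0 : Fin (d + 1)) ∉ Finset.univ.map (Fin.succEmb d) := by simp
  have huniv : (Finset.univ : Finset (Fin (d + 1)))
      = insert 0 (Finset.univ.map (Fin.succEmb d)) := by
    ext i; cases i using Fin.cases <;> simp
  rw [projCoeff, huniv, Finset.powersetCard_succ_insert h0, Finset.sum_union,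
    Finset.sum_image, Finset.powersetCard_map, Finset.powersetCard_map, Finset.sum_map,
    Finset.sum_map, projCoeff, projCoeff, Finset.mul_sum, Finset.mul_sum]
  · congr 1
    · refine Finset.sum_congr rfl fun S _ => ?_
      simp [List.ofFn_succ, Finset.mapEmbedding_apply]
    · refine Finset.sum_congr rfl fun S _ => ?_
      simp [List.ofFn_succ, Finset.mapEmbedding_apply, Fin.succ_ne_zero]
  · intro S hS T hT h
    have hS0 : 0 ∉ S := fun h => h0 ((Finset.mem_powersetCard.1 hS).1 h)
    have hT0 : 0 ∉ T := fun h => h0 ((Finset.mem_powersetCard.1 hT).1 h)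
    rw [← Finset.erase_insert hS0, h, Finset.erase_insert hT0]
  · refine Finset.disjoint_left.2 fun S hS hS' => ?_
    obtain ⟨T, -, rfl⟩ := Finset.mem_image.1 hS'
    exact h0 ((Finset.mem_powersetCard.1 hS).1 (Finset.mem_insert_self _ _))

theorem projCoeff_conjTranspose {r d : ℕ} (v : Fin d → Fin r → ℂ) (k : ℕ) :
    (projCoeff v k)ᴴ = projCoeff (fun j => v j.rev) k := by
  classical
  rw [projCoeff, projCoeff, conjTranspose_sum]
  have huniv : (Finset.univ : Finset (Fin d)) = Finset.univ.map Fin.revPerm.toEmbedding := by simp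
  conv_rhs => rw [huniv, Finset.powersetCard_map, Finset.sum_map]
  refine Finset.sum_congr rfl fun S _ => ?_
  rw [conjTranspose_list_prod]
  congr 1
  refine List.ext_getElem (by simp) fun i hi₁ hi₂ => ?_
  have hid : i < d := by simpa using hi₂
  -- the indices produced by `List.getElem_reverse`
  have hrev : (⟨d - 1 - i, by omega⟩ : Fin d) = Fin.rev ⟨i, hid⟩ :=
    Fin.ext (by simp only [Fin.val_rev]; omega)
  have hmem : (⟨i, hid⟩ : Fin d) ∈ (Finset.mapEmbedding Fin.revPerm.toEmbedding).toEmbedding S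
      ↔ Fin.rev ⟨i, hid⟩ ∈ S := by
    change _ ∈ Finset.map Fin.revPerm.toEmbedding S ↔ _
    simp
  simp only [List.getElem_reverse, List.getElem_map, List.getElem_ofFn, List.length_map,
    List.length_ofFn, hrev, hmem]
  split_ifs
  · rw [lineProj_conjTranspose]
  · rw [conjTranspose_sub, conjTranspose_one, lineProj_conjTranspose]

/-- The factorization of an isometric matrix polynomial into as many elementary factors as the
dimension of its Hankel space: each elementary factor split off lowers this dimension by one. -/
theorem exists_projCoeff_of_isOrthonormalSeq {p m n : ℕ} (d : ℕ)
    {b : ℕ → Matrix (Fin p) (Fin m) ℂ} (hb : ∀ k, n ≤ k → b k = 0)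
    (ho : IsOrthonormalSeq n b) (hd : Module.finrank ℂ (hankelSpace b) = d) :
    ∃ (v : Fin d → Fin p → ℂ) (U : Matrix (Fin p) (Fin m) ℂ),
      (∀ j, star (v j) ⬝ᵥ v j = 1) ∧ Uᴴ * U = 1 ∧ ∀ k, b k = projCoeff v k * U := by
  have hfin := finiteDimensional_hankelSpace hb
  induction d generalizing b with
  | zero =>
    have hbot : hankelSpace b = ⊥ := Submodule.finrank_eq_zero.1 hd
    have hsucc : ∀ k, b (k + 1) = 0 := fun k => by
      refine Matrix.ext_of_mulVec_single fun i => ?_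
      have h := mem_hankelSpace (b := b) k (Pi.single i 1)
      rw [hbot, Submodule.mem_bot] at h
      have h0 : b (0 + k + 1) *ᵥ Pi.single i 1 = 0 := congrFun h 0
      rw [zero_mulVec, ← h0, zero_add]
    refine ⟨Fin.elim0, b 0, fun j => j.elim0, ?_, ?_⟩
    · have h := ho 0
      rw [Finset.sum_eq_single 0] at h
      · simpa using h
      · intro k _ hk
        obtain ⟨k, rfl⟩ := Nat.exists_eq_succ_of_ne_zero hk
        simp [hsucc k]
      · intro hn
        simp [hb 0 (by simpa using hn)]
    · rintro (_ | k)
      · simp [projCoeff]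
      · rw [hsucc, projCoeff, Finset.powersetCard_eq_empty.2 (by simp)]
        simp
  | succ d ih =>
    have hne : hankelSpace b ≠ ⊥ := fun h => by
      rw [h, finrank_bot] at hd; omega
    obtain ⟨v₀, hv₀, hmem⟩ := exists_unit_single_mem_hankelSpace hb hne
    -- orthogonality of `(v₀, 0, 0, …)` to the columns `i ↦ b i u`
    have hv0 : (b 0)ᴴ *ᵥ v₀ = 0 := by
      have h := sum_conjTranspose_mulVec_eq_zero ho hmem
      rw [Finset.sum_eq_single 0] at h
      · simpa using h
      · intro k _ hk
        simp [Pi.single_eq_of_ne hk]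
      · intro hn
        simp [hb 0 (by simpa using hn)]
    have hL0 : lineProj v₀ * b 0 = 0 := by
      rw [lineProj, vecMulVec_mul, ← conjTranspose_conjTranspose (b 0), ← star_mulVec, hv0]
      ext
      simp [vecMulVec_apply]
    have hc : ∀ k, n ≤ k → peel v₀ b k = 0 := fun k hk => by
      simp [peel, hb k hk, hb (k + 1) (by omega)]
    have hrank := finrank_hankelSpace_peel hv₀ hmem
    obtain ⟨v, U, hv, hU, hvU⟩ := ih hc (peel_isOrthonormalSeq hb ho hv₀ hL0) (by omega)
      (finiteDimensional_hankelSpace hc)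
    refine ⟨Fin.cons v₀ v, U, fun j => ?_, hU, ?_⟩
    · cases j using Fin.cases
      · simpa using hv₀
      · simpa using hv _
    have hLL := lineProj_mul_self hv₀
    have hL : ∀ k, lineProj v₀ * peel v₀ b k = lineProj v₀ * b (k + 1) := fun k => by
      rw [peel, Matrix.mul_add, ← Matrix.mul_assoc, ← Matrix.mul_assoc, Matrix.mul_sub, hLL]
      simp
    have hQ : ∀ k, (1 - lineProj v₀) * peel v₀ b k = (1 - lineProj v₀) * b k := fun k => by
      rw [Matrix.sub_mul, hL, Matrix.one_mul, peel]
      simp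
    rintro (_ | k)
    · rw [projCoeff_cons_zero, Matrix.mul_assoc, ← hvU, hQ, Matrix.sub_mul, hL0]
      simp
    · rw [projCoeff_cons_succ, Matrix.add_mul, Matrix.mul_assoc, Matrix.mul_assoc, ← hvU, ← hvU,
        hQ, hL, Matrix.sub_mul]
      simp

/-! ### Realizations and Markov parameters -/

section Markov

open Filter Topology

/-- The coefficients `b 0 = B 1, …, b (n - 1) = B n`, extended by zero. -/
def firCoeff {p m : ℕ} (n : ℕ) (B : ℕ → Matrix (Fin p) (Fin m) ℂ) (k : ℕ) :
    Matrix (Fin p) (Fin m) ℂ :=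
  if k < n then B (k + 1) else 0

theorem firCoeff_eq_zero {p m n : ℕ} (B : ℕ → Matrix (Fin p) (Fin m) ℂ) {k : ℕ} (hk : n ≤ k) :
    firCoeff n B k = 0 :=
  if_neg (not_lt.2 hk)

theorem causalFIR_eq_sum_firCoeff {p m : ℕ} (n : ℕ) (B : ℕ → Matrix (Fin p) (Fin m) ℂ) (z : ℂ) :
    causalFIR n B z = ∑ k ∈ Finset.range n, z⁻¹ ^ k • firCoeff n B k := by
  rw [causalFIR, ← Finset.Ico_succ_right_eq_Icc, Finset.sum_Ico_eq_sum_range]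
  refine Finset.sum_congr (by simp) fun k hk => ?_
  have hk' : k < n := by simpa using hk
  rw [firCoeff, if_pos hk', add_comm 1 k]
  congr 1
  rw [show (1 : ℤ) - ((k + 1 : ℕ) : ℤ) = -(k : ℤ) by push_cast; ring, _root_.zpow_neg, zpow_natCast,
    inv_pow]

/-- `A, G, C` realize the Markov parameters `b 1, b 2, …`, that is, `b (k + 1) = C A ^ k G`; the
constant term `b 0` is not involved. -/
def IsMarkovRealization {p m ν : ℕ} (b : ℕ → Matrix (Fin p) (Fin m) ℂ)
    (A : Matrix (Fin ν) (Fin ν) ℂ) (G : Matrix (Fin ν) (Fin m) ℂ)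
    (C : Matrix (Fin p) (Fin ν) ℂ) : Prop :=
  ∀ k, b (k + 1) = C * A ^ k * G

section Realization
variable {p m ν n : ℕ} {b : ℕ → Matrix (Fin p) (Fin m) ℂ} {A : Matrix (Fin ν) (Fin ν) ℂ}
  {G : Matrix (Fin ν) (Fin m) ℂ} {C : Matrix (Fin p) (Fin ν) ℂ}

theorem IsMarkovRealization.conjTranspose (h : IsMarkovRealization b A G C) :
    IsMarkovRealization (fun k => (b k)ᴴ) Aᴴ Cᴴ Gᴴ := fun k => by
  change (b (k + 1))ᴴ = _
  rw [h k, conjTranspose_mul, conjTranspose_mul, conjTranspose_pow, Matrix.mul_assoc]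

theorem IsMarkovRealization.finrank_hankelSpace_le (h : IsMarkovRealization b A G C) :
    Module.finrank ℂ (hankelSpace b) ≤ ν := by
  let f : (Fin ν → ℂ) →ₗ[ℂ] (ℕ → Fin p → ℂ) := LinearMap.pi fun i => (C * A ^ i).mulVecLin
  have hle : hankelSpace b ≤ LinearMap.range f := by
    refine Submodule.span_le.2 ?_
    rintro _ ⟨j, u, rfl⟩
    refine ⟨(A ^ j * G) *ᵥ u, ?_⟩
    funext i
    simp [f, h (i + j), pow_add, Matrix.mul_assoc]
  refine (Submodule.finrank_mono hle).trans ?_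
  simpa using LinearMap.finrank_range_le f

theorem eventually_isUnit_det_one_sub_smul (A : Matrix (Fin ν) (Fin ν) ℂ) :
    ∀ᶠ w : ℂ in 𝓝 0, IsUnit (1 - w • A).det := by
  have hc : Continuous fun w : ℂ => (1 - w • A).det := by fun_prop
  have h : ∀ᶠ w : ℂ in 𝓝 0, (1 - w • A).det ≠ 0 :=
    hc.continuousAt.eventually_ne (by simp)
  exact h.mono fun w hw => isUnit_iff_ne_zero.2 hw

theorem tendsto_inv_one_sub_smul (A : Matrix (Fin ν) (Fin ν) ℂ) :
    Tendsto (fun w : ℂ => (1 - w • A)⁻¹) (𝓝[≠] 0) (𝓝 1) := by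
  have h1 : Continuous fun w : ℂ => (1 - w • A).det := by fun_prop
  have h2 : Continuous fun w : ℂ => (1 - w • A).adjugate := by fun_prop
  have h3 : Tendsto (fun w : ℂ => ((1 - w • A).det)⁻¹ • (1 - w • A).adjugate) (𝓝 0)
      (𝓝 (((1 - (0 : ℂ) • A).det)⁻¹ • (1 - (0 : ℂ) • A).adjugate)) :=
    (h1.continuousAt.inv₀ (by simp)).tendsto.smul h2.continuousAt.tendsto
  simp only [zero_smul, sub_zero, det_one, inv_one, adjugate_one, one_smul] at h3
  refine (h3.mono_left nhdsWithin_le_nhds).congr fun w => ?_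
  rw [Matrix.inv_def, Ring.inverse_eq_inv']

/-- Comparing two expansions at `w = 0` and cancelling a factor `w`. -/
theorem eq_and_eventually_of_eventually_sum_eq {M : ℕ → Matrix (Fin p) (Fin m) ℂ}
    {H : ℂ → Matrix (Fin p) (Fin m) ℂ} {D H₀ : Matrix (Fin p) (Fin m) ℂ}
    (hM : ∀ k, n ≤ k → M k = 0) (hH : Tendsto H (𝓝[≠] 0) (𝓝 H₀))
    (h : ∀ᶠ w : ℂ in 𝓝[≠] 0, ∑ k ∈ Finset.range n, w ^ k • M k = D + w • H w) :
    M 0 = D ∧ ∀ᶠ w : ℂ in 𝓝[≠] 0, ∑ k ∈ Finset.range n, w ^ k • M (k + 1) = H w := by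
  have hsum : ∀ w : ℂ, ∑ k ∈ Finset.range n, w ^ k • M k
      = M 0 + w • ∑ k ∈ Finset.range n, w ^ k • M (k + 1) := by
    intro w
    have h1 := Finset.sum_range_succ (fun k => w ^ k • M k) n
    rw [Finset.sum_range_succ', hM n le_rfl, smul_zero, add_zero, pow_zero, one_smul] at h1
    rw [← h1, add_comm, Finset.smul_sum]
    simp only [smul_smul, pow_succ']
  have h0 : M 0 = D := by
    have hl : Tendsto (fun w : ℂ => ∑ k ∈ Finset.range n, w ^ k • M k) (𝓝[≠] 0) (𝓝 (M 0)) := by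
      have hc : Continuous fun w : ℂ => M 0 + w • ∑ k ∈ Finset.range n, w ^ k • M (k + 1) := by
        fun_prop
      have := hc.tendsto 0
      simp only [zero_smul, add_zero, ← hsum] at this
      exact this.mono_left nhdsWithin_le_nhds
    have hr : Tendsto (fun w : ℂ => D + w • H w) (𝓝[≠] 0) (𝓝 (D + (0 : ℂ) • H₀)) :=
      tendsto_const_nhds.add ((tendsto_id.mono_left nhdsWithin_le_nhds).smul hH)
    rw [zero_smul, add_zero] at hr
    exact tendsto_nhds_unique hl (hr.congr' (h.mono fun w hw => hw.symm))
  refine ⟨h0, ?_⟩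
  filter_upwards [h, self_mem_nhdsWithin] with w hw hw0
  rw [hsum, h0] at hw
  exact smul_right_injective _ hw0 (add_left_cancel hw)

theorem tendsto_mul_inv_one_sub_smul_mul (A : Matrix (Fin ν) (Fin ν) ℂ)
    (G : Matrix (Fin ν) (Fin m) ℂ) (C : Matrix (Fin p) (Fin ν) ℂ) :
    Tendsto (fun w : ℂ => C * (1 - w • A)⁻¹ * G) (𝓝[≠] 0) (𝓝 (C * G)) := by
  have hc : Continuous fun X : Matrix (Fin ν) (Fin ν) ℂ => C * X * G := by fun_prop
  have h := (hc.tendsto 1).comp (tendsto_inv_one_sub_smul A)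
  rwa [Matrix.mul_one] at h

theorem eq_mul_pow_mul_of_eventually_sum_eq {M : ℕ → Matrix (Fin p) (Fin m) ℂ}
    (hM : ∀ k, n ≤ k → M k = 0)
    (h : ∀ᶠ w : ℂ in 𝓝[≠] 0,
      ∑ k ∈ Finset.range n, w ^ k • M k = C * (1 - w • A)⁻¹ * G) (k : ℕ) :
    M k = C * A ^ k * G := by
  -- `(1 - w A)⁻¹ = 1 + w A (1 - w A)⁻¹`, so passing to the shifted sequence replaces `C` by `C A`
  have hstep : ∀ {M : ℕ → Matrix (Fin p) (Fin m) ℂ} {C : Matrix (Fin p) (Fin ν) ℂ},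
      (∀ k, n ≤ k → M k = 0) →
      (∀ᶠ w : ℂ in 𝓝[≠] 0,
        ∑ k ∈ Finset.range n, w ^ k • M k = C * (1 - w • A)⁻¹ * G) →
      M 0 = C * G ∧ ∀ᶠ w : ℂ in 𝓝[≠] 0,
        ∑ k ∈ Finset.range n, w ^ k • M (k + 1) = C * A * (1 - w • A)⁻¹ * G := by
    intro M C hM h
    refine eq_and_eventually_of_eventually_sum_eq hM
      (tendsto_mul_inv_one_sub_smul_mul A G (C * A)) ?_
    filter_upwards [h,
      (eventually_isUnit_det_one_sub_smul A).filter_mono nhdsWithin_le_nhds] with w hw hu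
    have hinv : (1 - w • A)⁻¹ = 1 + w • (A * (1 - w • A)⁻¹) := by
      have := mul_nonsing_inv _ hu
      rwa [Matrix.sub_mul, Matrix.one_mul, Matrix.smul_mul, sub_eq_iff_eq_add] at this
    rw [hw]
    conv_lhs => rw [hinv]
    simp only [Matrix.mul_add, Matrix.add_mul, Matrix.mul_one, Matrix.mul_smul, Matrix.smul_mul,
      Matrix.mul_assoc]
  induction k generalizing M C with
  | zero => simpa using (hstep hM h).1
  | succ k ih =>
    rw [ih (M := fun k => M (k + 1)) (fun k hk => hM _ (by omega)) (hstep hM h).2, pow_succ',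
      Matrix.mul_assoc C]

theorem IsRealization.isMarkovRealization {B : ℕ → Matrix (Fin p) (Fin m) ℂ}
    {D : Matrix (Fin p) (Fin m) ℂ} (h : IsRealization (causalFIR n B) A G C D) :
    IsMarkovRealization (firCoeff n B) A G C := by
  refine eq_mul_pow_mul_of_eventually_sum_eq (n := n)
    (fun k hk => firCoeff_eq_zero B (by omega))
    (eq_and_eventually_of_eventually_sum_eq (D := D) (fun k hk => firCoeff_eq_zero B hk)
      (tendsto_mul_inv_one_sub_smul_mul A G C) ?_).2
  have hz := (tendsto_inv₀_nhdsNE_zero (α := ℂ)).eventually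
    (h.filter_mono (Bornology.le_cofinite ℂ))
  filter_upwards [hz, self_mem_nhdsWithin,
    (eventually_isUnit_det_one_sub_smul A).filter_mono nhdsWithin_le_nhds] with w hw hw0 hu
  have hw0' : w ≠ 0 := hw0
  have hinv : (w⁻¹ • (1 : Matrix (Fin ν) (Fin ν) ℂ) - A)⁻¹ = w • (1 - w • A)⁻¹ := by
    refine inv_eq_right_inv ?_
    rw [Matrix.mul_smul, ← Matrix.smul_mul, smul_sub, smul_smul, mul_inv_cancel₀ hw0', one_smul,
      mul_nonsing_inv _ hu]
  rw [causalFIR_eq_sum_firCoeff, inv_inv, hinv] at hw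
  rw [hw, Matrix.mul_smul, Matrix.smul_mul, add_comm]

/-- The shift realization: the state space is the Hankel space, the state operator the backward
shift, the input `u ↦ (i ↦ b (i + 1) u)` and the output `x ↦ x 0`. -/
theorem exists_isMarkovRealization_finrank (hb : ∀ k, n ≤ k → b k = 0) :
    ∃ (A : Matrix (Fin (Module.finrank ℂ (hankelSpace b)))
        (Fin (Module.finrank ℂ (hankelSpace b))) ℂ)
      (G : Matrix (Fin (Module.finrank ℂ (hankelSpace b))) (Fin m) ℂ)
      (C : Matrix (Fin p) (Fin (Module.finrank ℂ (hankelSpace b))) ℂ),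
      A ^ n = 0 ∧ IsMarkovRealization b A G C := by
  have hfin := finiteDimensional_hankelSpace hb
  let e := Module.finBasis ℂ (hankelSpace b)
  let S : hankelSpace b →ₗ[ℂ] hankelSpace b :=
    (backwardShift p).restrict fun x hx => backwardShift_mem_hankelSpace hx
  have hS : ∀ (k : ℕ) (x : hankelSpace b), ((S ^ k) x).1 = (backwardShift p ^ k) x.1 := by
    intro k x
    induction k with
    | zero => rfl
    | succ k ih => rw [pow_succ', pow_succ', Module.End.mul_apply, Module.End.mul_apply, ← ih]; rfl
  let g : (Fin m → ℂ) →ₗ[ℂ] hankelSpace b :=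
    LinearMap.codRestrict _ (LinearMap.pi fun i => (b (i + 0 + 1)).mulVecLin)
      fun u => mem_hankelSpace 0 u
  let c : hankelSpace b →ₗ[ℂ] (Fin p → ℂ) :=
    (LinearMap.proj 0).comp (hankelSpace b).subtype
  refine ⟨LinearMap.toMatrix e e S, LinearMap.toMatrix (Pi.basisFun ℂ _) e g,
    LinearMap.toMatrix e (Pi.basisFun ℂ _) c, ?_, fun k => ?_⟩
  · rw [LinearMap.toMatrix_pow]
    have : S ^ n = 0 := by
      ext x i : 3
      rw [hS, backwardShift_pow_apply, eq_zero_of_mem_hankelSpace hb x.2 (by omega)]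
      rfl
    rw [this, map_zero]
  · rw [LinearMap.toMatrix_pow, ← LinearMap.toMatrix_comp, ← LinearMap.toMatrix_comp]
    have : (c ∘ₗ S ^ k) ∘ₗ g = (b (k + 1)).mulVecLin := by
      refine LinearMap.ext fun u => ?_
      change ((S ^ k) (g u)).1 0 = _
      rw [hS, backwardShift_pow_apply]
      change b (0 + k + 0 + 1) *ᵥ u = _
      simp
    rw [this]
    exact (LinearMap.toMatrix'_toLin' (b (k+1))).symm

/-- For nilpotent `A` the resolvent of `A` is a finite sum, valid for all `z ≠ 0`. -/
theorem IsMarkovRealization.isRealization {B : ℕ → Matrix (Fin p) (Fin m) ℂ}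
    (hA : A ^ n = 0) (h : IsMarkovRealization (firCoeff n B) A G C) :
    IsRealization (causalFIR n B) A G C (firCoeff n B 0) := by
  filter_upwards [eventually_cofinite_ne (0 : ℂ)] with z hz
  have hinv : (z • (1 : Matrix (Fin ν) (Fin ν) ℂ) - A)⁻¹
      = ∑ k ∈ Finset.range n, z⁻¹ ^ (k + 1) • A ^ k := by
    refine inv_eq_right_inv ?_
    have hterm : ∀ k, (z • (1 : Matrix (Fin ν) (Fin ν) ℂ) - A) * (z⁻¹ ^ (k + 1) • A ^ k)
        = z⁻¹ ^ k • A ^ k - z⁻¹ ^ (k + 1) • A ^ (k + 1) := fun k => by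
      rw [Matrix.sub_mul, Matrix.smul_mul, Matrix.one_mul, Matrix.mul_smul, smul_smul, pow_succ',
        mul_inv_cancel_left₀ hz, pow_succ' A]
    rw [Finset.mul_sum, Finset.sum_congr rfl fun k _ => hterm k,
      Finset.sum_range_sub' (fun k => z⁻¹ ^ k • A ^ k), hA]
    simp
  have h1 := Finset.sum_range_succ (fun k => z⁻¹ ^ k • firCoeff n B k) n
  rw [Finset.sum_range_succ', firCoeff_eq_zero B le_rfl, smul_zero, add_zero, pow_zero,
    one_smul] at h1
  rw [causalFIR_eq_sum_firCoeff, ← h1, hinv, Matrix.mul_sum, Matrix.sum_mul]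
  congr 1
  refine Finset.sum_congr rfl fun k _ => ?_
  rw [h k, Matrix.mul_smul, Matrix.smul_mul]

end Realization

end Markov

/-! ### From functions on the unit circle to coefficients -/

theorem infinite_setOf_norm_eq_one : {w : ℂ | ‖w‖ = 1}.Infinite := by
  have h : IsPreconnected (Metric.sphere (0 : ℂ) 1) :=
    isPreconnected_sphere (by rw [Complex.rank_real_complex]; norm_num) 0 1
  have hs : {w : ℂ | ‖w‖ = 1} = Metric.sphere (0 : ℂ) 1 := by ext; simp
  rw [hs]
  exact h.infinite_of_nontrivial ⟨1, by simp, -1, by simp, by norm_num⟩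

/-- An isometric matrix polynomial has orthonormal coefficients: `w ^ n P(w)* P(w)` agrees on the
unit circle with a polynomial, whose coefficients at `n + j` are the correlations at lag `j`. -/
theorem isOrthonormalSeq_of_isometric {p m n : ℕ} {b : ℕ → Matrix (Fin p) (Fin m) ℂ}
    (hb : ∀ k, n ≤ k → b k = 0)
    (h : ∀ w : ℂ, ‖w‖ = 1 → (∑ k ∈ Finset.range n, w ^ k • b k)ᴴ
      * (∑ k ∈ Finset.range n, w ^ k • b k) = 1) : IsOrthonormalSeq n b := by
  intro j
  ext r s
  let f : Polynomial ℂ := ∑ k ∈ Finset.range n, ∑ l ∈ Finset.range n,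
    Polynomial.C (((b k)ᴴ * b l) r s) * Polynomial.X ^ (n - k + l)
  have hf : f = Polynomial.C ((1 : Matrix (Fin m) (Fin m) ℂ) r s) * Polynomial.X ^ n := by
    refine Polynomial.eq_of_infinite_eval_eq _ _ (infinite_setOf_norm_eq_one.mono fun w hw => ?_)
    have hw' : star w * w = 1 := by
      have h1 : ‖w‖ = 1 := hw
      rw [← starRingEnd_apply, Complex.conj_mul', h1]
      simp
    have hpow : ∀ k l, k < n → w ^ n * (star w ^ k * w ^ l) = w ^ (n - k + l) := by
      intro k l hk
      have hn : w ^ n = w ^ (n - k) * w ^ k := by rw [← pow_add, Nat.sub_add_cancel hk.le]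
      calc w ^ n * (star w ^ k * w ^ l) = w ^ (n - k) * (star w * w) ^ k * w ^ l := by
            rw [hn, mul_pow]; ring
        _ = w ^ (n - k + l) := by rw [hw', one_pow, mul_one, pow_add]
    simp only [Set.mem_ofPred_eq, f, Polynomial.eval_finsetSum, Polynomial.eval_mul,
      Polynomial.eval_C, Polynomial.eval_pow, Polynomial.eval_X]
    rw [← h w hw, conjTranspose_sum, Matrix.sum_mul, Matrix.sum_apply, Finset.sum_mul]
    refine Finset.sum_congr rfl fun k hk => ?_
    rw [Matrix.mul_sum, Matrix.sum_apply, Finset.sum_mul]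
    refine Finset.sum_congr rfl fun l _ => ?_
    rw [← hpow k l (Finset.mem_range.1 hk), conjTranspose_smul, Matrix.smul_mul, Matrix.mul_smul,
      Matrix.smul_apply, Matrix.smul_apply, star_pow, smul_eq_mul, smul_eq_mul]
    ring
  have hcoeff := congrArg (fun q => Polynomial.coeff q (n + j)) hf
  simp only [f, Polynomial.finsetSum_coeff, Polynomial.coeff_C_mul, Polynomial.coeff_X_pow]
    at hcoeff
  rw [Matrix.sum_apply]
  calc ∑ k ∈ Finset.range n, ((b k)ᴴ * b (k + j)) r s
      = ∑ k ∈ Finset.range n, ∑ l ∈ Finset.range n,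
          ((b k)ᴴ * b l) r s * if n + j = n - k + l then 1 else 0 := by
        refine Finset.sum_congr rfl fun k hk => ?_
        have hk' := Finset.mem_range.1 hk
        rw [Finset.sum_eq_single (k + j)]
        · rw [if_pos (by omega), mul_one]
        · intro l _ hl
          rw [if_neg (by omega), mul_zero]
        · intro hkj
          simp [hb (k + j) (by simpa using hkj)]
    _ = _ := by
        rw [hcoeff]
        by_cases hj : j = 0 <;> simp [hj]

theorem isOrthonormalSeq_firCoeff {p m n : ℕ} {B : ℕ → Matrix (Fin p) (Fin m) ℂ}
    (h : ∀ z : ℂ, ‖z‖ = 1 → (causalFIR n B z)ᴴ * causalFIR n B z = 1) :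
    IsOrthonormalSeq n (firCoeff n B) := by
  refine isOrthonormalSeq_of_isometric (fun k hk => firCoeff_eq_zero B hk) fun w hw => ?_
  have := h w⁻¹ (by simp [hw])
  rwa [causalFIR_eq_sum_firCoeff, inv_inv] at this

/-- The adjoint coefficients belong to the isometric polynomial `w ↦ F((star w)⁻¹)*`. -/
theorem isOrthonormalSeq_conjTranspose_firCoeff {p m n : ℕ} {B : ℕ → Matrix (Fin p) (Fin m) ℂ}
    (h : ∀ z : ℂ, ‖z‖ = 1 → causalFIR n B z * (causalFIR n B z)ᴴ = 1) :
    IsOrthonormalSeq n fun k => (firCoeff n B k)ᴴ := by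
  refine isOrthonormalSeq_of_isometric (fun k hk => by rw [firCoeff_eq_zero B hk]; simp)
    fun w hw => ?_
  have hF : causalFIR n B (star w)⁻¹ = (∑ k ∈ Finset.range n, w ^ k • (firCoeff n B k)ᴴ)ᴴ := by
    rw [causalFIR_eq_sum_firCoeff, inv_inv, conjTranspose_sum]
    simp
  have := h (star w)⁻¹ (by simp [hw])
  rwa [hF, conjTranspose_conjTranspose] at this

/-- The McMillan degree is the rank of the Hankel operator. -/
theorem HasMcMillanDegree.finrank_hankelSpace {p m n d : ℕ} {B : ℕ → Matrix (Fin p) (Fin m) ℂ}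
    (h : HasMcMillanDegree (causalFIR n B) d) :
    Module.finrank ℂ (hankelSpace (firCoeff n B)) = d := by
  refine le_antisymm ?_ (h.2 ?_)
  · obtain ⟨A, G, C, D, hr⟩ := h.1
    exact hr.isMarkovRealization.finrank_hankelSpace_le
  · obtain ⟨A, G, C, hA, hr⟩ :=
      exists_isMarkovRealization_finrank (n := n) fun k hk => firCoeff_eq_zero B hk
    exact ⟨A, G, C, _, hr.isRealization hA⟩

/-- Block Hankel matrices of `b` and of its adjoints have the same rank, since realizations of one
are adjoints of realizations of the other. -/
theorem finrank_hankelSpace_conjTranspose {p m n : ℕ} {b : ℕ → Matrix (Fin p) (Fin m) ℂ}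
    (hb : ∀ k, n ≤ k → b k = 0) :
    Module.finrank ℂ (hankelSpace fun k => (b k)ᴴ) = Module.finrank ℂ (hankelSpace b) := by
  apply le_antisymm
  · obtain ⟨A, G, C, -, hr⟩ := exists_isMarkovRealization_finrank hb
    exact hr.conjTranspose.finrank_hankelSpace_le
  · obtain ⟨A, G, C, -, hr⟩ := exists_isMarkovRealization_finrank (n := n)
      (b := fun k => (b k)ᴴ) fun k hk => by rw [hb k hk, conjTranspose_zero]
    have hr' := hr.conjTranspose
    simp only [conjTranspose_conjTranspose] at hr'
    exact hr'.finrank_hankelSpace_le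

theorem exists_projCoeff_mul_of_isometric {n d p m : ℕ} {B : ℕ → Matrix (Fin p) (Fin m) ℂ}
    (hF : ∀ z : ℂ, ‖z‖ = 1 → (causalFIR n B z)ᴴ * causalFIR n B z = 1)
    (hd : HasMcMillanDegree (causalFIR n B) d) :
    ∃ (v : Fin d → Fin p → ℂ) (U : Matrix (Fin p) (Fin m) ℂ),
      (∀ j, star (v j) ⬝ᵥ v j = 1) ∧ Uᴴ * U = 1 ∧
      (∀ k, k < n → B (k + 1) = projCoeff v k * U) ∧
      (∀ k, n ≤ k → projCoeff v k * U = 0) := by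
  obtain ⟨v, U, hv, hU, h⟩ := exists_projCoeff_of_isOrthonormalSeq d
    (fun k hk => firCoeff_eq_zero B hk) (isOrthonormalSeq_firCoeff hF) hd.finrank_hankelSpace
  refine ⟨v, U, hv, hU, fun k hk => ?_, fun k hk => ?_⟩
  · rw [← h k, firCoeff, if_pos hk]
  · rw [← h k, firCoeff_eq_zero B hk]

theorem exists_mul_projCoeff_of_coisometric {n d p m : ℕ} {B : ℕ → Matrix (Fin p) (Fin m) ℂ}
    (hF : ∀ z : ℂ, ‖z‖ = 1 → causalFIR n B z * (causalFIR n B z)ᴴ = 1)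
    (hd : HasMcMillanDegree (causalFIR n B) d) :
    ∃ (v : Fin d → Fin m → ℂ) (U : Matrix (Fin p) (Fin m) ℂ),
      (∀ j, star (v j) ⬝ᵥ v j = 1) ∧ U * Uᴴ = 1 ∧
      (∀ k, k < n → B (k + 1) = U * projCoeff v k) ∧
      (∀ k, n ≤ k → U * projCoeff v k = 0) := by
  obtain ⟨v, U, hv, hU, h⟩ := exists_projCoeff_of_isOrthonormalSeq d
    (fun k hk => by rw [firCoeff_eq_zero B hk, conjTranspose_zero])
    (isOrthonormalSeq_conjTranspose_firCoeff hF)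
    ((finrank_hankelSpace_conjTranspose fun k hk => firCoeff_eq_zero B hk).trans
      hd.finrank_hankelSpace)
  have h' : ∀ k, firCoeff n B k = Uᴴ * projCoeff (fun j => v j.rev) k := fun k => by
    rw [← projCoeff_conjTranspose, ← conjTranspose_mul, ← h k, conjTranspose_conjTranspose]
  refine ⟨fun j => v j.rev, Uᴴ, fun j => hv _, by rwa [conjTranspose_conjTranspose],
    fun k hk => ?_, fun k hk => ?_⟩
  · rw [← h' k, firCoeff, if_pos hk]
  · rw [← h' k, firCoeff_eq_zero B hk]

theorem mainTheorem7 (n d : ℕ) :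
    -- the square case
    (∀ (p : ℕ) (B : ℕ → Matrix (Fin p) (Fin p) ℂ),
      InClassU (causalFIR n B) → HasMcMillanDegree (causalFIR n B) d →
      (∃ (v : Fin d → Fin p → ℂ) (U : Matrix (Fin p) (Fin p) ℂ),
        (∀ j, star (v j) ⬝ᵥ v j = 1) ∧ U ∈ Matrix.unitaryGroup (Fin p) ℂ ∧
        (∀ k, k < n → B (k + 1) = projCoeff v k * U) ∧
        (∀ k, n ≤ k → projCoeff v k * U = 0)) ∧
      (∃ (v : Fin d → Fin p → ℂ) (U : Matrix (Fin p) (Fin p) ℂ),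
        (∀ j, star (v j) ⬝ᵥ v j = 1) ∧ U ∈ Matrix.unitaryGroup (Fin p) ℂ ∧
        (∀ k, k < n → B (k + 1) = U * projCoeff v k) ∧
        (∀ k, n ≤ k → U * projCoeff v k = 0))) ∧
    -- the isometric case
    (∀ (p m : ℕ) (B : ℕ → Matrix (Fin p) (Fin m) ℂ), m ≤ p →
      InClassU (causalFIR n B) → HasMcMillanDegree (causalFIR n B) d →
      ∃ (v : Fin d → Fin p → ℂ) (U : Matrix (Fin p) (Fin m) ℂ),
        (∀ j, star (v j) ⬝ᵥ v j = 1) ∧ Uᴴ * U = 1 ∧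
        (∀ k, k < n → B (k + 1) = projCoeff v k * U) ∧
        (∀ k, n ≤ k → projCoeff v k * U = 0)) ∧
    -- the co-isometric case
    (∀ (p m : ℕ) (B : ℕ → Matrix (Fin p) (Fin m) ℂ), p ≤ m →
      InClassU (causalFIR n B) → HasMcMillanDegree (causalFIR n B) d →
      ∃ (v : Fin d → Fin m → ℂ) (U : Matrix (Fin p) (Fin m) ℂ),
        (∀ j, star (v j) ⬝ᵥ v j = 1) ∧ U * Uᴴ = 1 ∧
        (∀ k, k < n → B (k + 1) = U * projCoeff v k) ∧
        (∀ k, n ≤ k → U * projCoeff v k = 0)) := by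
  refine ⟨fun p B hF hd => ⟨?_, ?_⟩, fun p m B hpm hF hd =>
    exists_projCoeff_mul_of_isometric (hF.1 hpm) hd, fun p m B hpm hF hd =>
    exists_mul_projCoeff_of_coisometric (hF.2 hpm) hd⟩
  · obtain ⟨v, U, hv, hU, h⟩ := exists_projCoeff_mul_of_isometric (hF.1 le_rfl) hd
    exact ⟨v, U, hv, Matrix.mem_unitaryGroup_iff'.2 hU, h⟩
  · obtain ⟨v, U, hv, hU, h⟩ := exists_mul_projCoeff_of_coisometric (hF.2 le_rfl) hd
    exact ⟨v, U, hv, Matrix.mem_unitaryGroup_iff.2 hU, h⟩
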